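/- Let a configuration $(x,y,\theta)$ be a point $(x,y)\in\mathbb{R}^2$ together with an orientation, given by an angle $\theta$ with the positive $x$-axis. A bounded-curvature path of length $L\ge 0$ from $\sigma=(x,y,\theta)$ to $\sigma'=(x',y',\theta')$ is a differentiable curve $\gamma:[0,L]\to\mathbb{R}^2$ parametrized by arc length whose unit tangent $\gamma'$ is $1$-Lipschitz (i.e. $\gamma'$ is absolutely continuous and the curvature is at most $1$ almost everywhere), with $\gamma(0)=(x,y)$, $\gamma(L)=(x',y')$, and with tangent $(\cos\theta,\sin\theta)$ at $0$ and $(\cos\theta',\sin\theta')$ at $L$. Let $\ell(\sigma,\sigma')$ be the infimum of the lengths of such paths, and write $\ell(d,\alpha,\beta)=\ell\big((0,0,\alpha),(d,0,\beta)\big)$. Define $$\mathrm{dub}(d)=\sup\{\ell(\sigma,\sigma')-d \mid \text{the locations of } \sigma,\sigma' \text{ are at Euclidean distance } d\}.$$ Let $\Delta=\{(\alpha,\beta) : 0\le\alpha\le\pi,\ \alpha\le\beta\le 2\pi-\alpha\}$, and let $C^\Delta$ be the set of $(\alpha,\beta)\in\Delta$ for which the center $(-\sin\alpha,\cos\alpha)$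 of the unit disk to the left of $(0,0,\alpha)$ and the center $(d+\sin\beta,-\cos\beta)$ of the unit disk to the right of $(d,0,\beta)$ have distance at least $2$ (equivalently, the corresponding open disks are disjoint). Put $$\mathrm{dub}_C(d)=\sup_{(\alpha,\beta)\in C^\Delta}\ell(d,\alpha,\beta)-d.$$ Lemma. For every $d>0$, $\mathrm{dub}_C(d)=2\pi$. Moreover $(\pi,\pi)\in C^\Delta$, a shortest bounded-curvature path from $(0,0,\pi)$ to $(d,0,\pi)$ exists and has length exactly $d+2\pi$, and consequently $\mathrm{dub}(d)\ge 2\pi$. -/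

import Mathlib

open Real Set

/-- A configuration of the robot: a location in the Euclidean plane and an orientation, given as
an angle with the positive `x`-axis. -/
structure Configuration where
  pos : EuclideanSpace ℝ (Fin 2)
  angle : ℝ

namespace Configuration

/-- The configuration `(x, y, θ)`. -/
noncomputable def of (x y θ : ℝ) : Configuration := ⟨!₂[x, y], θ⟩

/-- The unit direction vector of a configuration. -/
noncomputable def dir (σ : Configuration) : EuclideanSpace ℝ (Fin 2) :=
  !₂[cos σ.angle, sin σ.angle]

/-- The center of the unit disk tangent to the configuration on its left side. -/
noncomputable def leftCenter (σ : Configuration) : EuclideanSpace ℝ (Fin 2) :=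
  σ.pos + !₂[-sin σ.angle, cos σ.angle]

/-- The center of the unit disk tangent to the configuration on its right side. -/
noncomputable def rightCenter (σ : Configuration) : EuclideanSpace ℝ (Fin 2) :=
  σ.pos + !₂[sin σ.angle, -cos σ.angle]

end Configuration

/-- `γ`, restricted to `[0, L]`, is a bounded-curvature path of length `L` from `σ` to `σ'`:
it is differentiable and parametrized by arc length, its unit tangent `v` is `1`-Lipschitz
(that is, `v` is absolutely continuous and the curvature `‖v'‖` is at most one almost
everywhere), and it has the prescribed locations and directions at its two ends. -/
def IsBoundedCurvaturePath (σ σ' : Configuration) (L : ℝ)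
    (γ : ℝ → EuclideanSpace ℝ (Fin 2)) : Prop :=
  0 ≤ L ∧ ∃ v : ℝ → EuclideanSpace ℝ (Fin 2),
    (∀ t ∈ Icc 0 L, HasDerivWithinAt γ (v t) (Icc 0 L) t) ∧
    (∀ t ∈ Icc 0 L, ‖v t‖ = 1) ∧
    LipschitzOnWith 1 v (Icc 0 L) ∧
    γ 0 = σ.pos ∧ v 0 = σ.dir ∧ γ L = σ'.pos ∧ v L = σ'.dir

/-- The set of lengths of all bounded-curvature paths from `σ` to `σ'`. -/
def pathLengths (σ σ' : Configuration) : Set ℝ :=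
  {L | ∃ γ : ℝ → EuclideanSpace ℝ (Fin 2), IsBoundedCurvaturePath σ σ' L γ}

/-- The length `ℓ(σ, σ')` of a shortest bounded-curvature path, as an infimum
(`⊤` if there were no path). -/
noncomputable def shortestLength (σ σ' : Configuration) : EReal :=
  ⨅ L ∈ pathLengths σ σ', (L : EReal)

/-- The Dubins cost function: the supremum of `ℓ(σ, σ') - d` over all pairs of configurations
whose locations are at Euclidean distance `d`. -/
noncomputable def dub (d : ℝ) : EReal :=
  ⨆ (σ : Configuration) (σ' : Configuration) (_ : dist σ.pos σ'.pos = d),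
    (shortestLength σ σ' - (d : EReal))

/-- `ℓ(d, α, β)`, from `(0, 0, α)` to `(d, 0, β)`. -/
noncomputable def ell (d α β : ℝ) : EReal :=
  shortestLength (Configuration.of 0 0 α) (Configuration.of d 0 β)

/-- The triangle `Δ` with corners `(0, 0)`, `(π, π)`, `(0, 2π)` in the `(α, β)`-plane. -/
def triangleDelta : Set (ℝ × ℝ) :=
  {p | 0 ≤ p.1 ∧ p.1 ≤ π ∧ p.1 ≤ p.2 ∧ p.2 ≤ 2 * π - p.1}

/-- The distance `d_LR` between the center of the left disk at the start `(0, 0, α)` and the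
center of the right disk at the end `(d, 0, β)`. -/
noncomputable def dLR (d α β : ℝ) : ℝ :=
  dist (Configuration.of 0 0 α).leftCenter (Configuration.of d 0 β).rightCenter

/-- Case C inside `Δ`: the open left disk at the start and the open right disk at the end are
disjoint, that is, the path of type `LSR` exists. -/
def regionCDelta (d : ℝ) : Set (ℝ × ℝ) :=
  {p | p ∈ triangleDelta ∧ 2 ≤ dLR d p.1 p.2}

/-- The Dubins cost function restricted to case C. -/
noncomputable def dubC (d : ℝ) : EReal :=
  ⨆ p ∈ regionCDelta d, (ell d p.1 p.2 - (d : EReal))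

/-! ### Paths with a prescribed heading function -/

/-! Lower bound: a unit tangent that is `1`-Lipschitz turns by at most `t` in time `t`. Starting
with heading `π`, the abscissa after time `t ≤ π` is at most `-sin t`, so the first `π` units of
length yield no progress to the right. By symmetry neither do the last `π`, and the displacement `d`
must be made in between at speed at most `1` (`add_two_pi_le_of_mem_pathLengths`).

Upper bound: two explicit paths suffice. In right-straight-right the heading of the segment cancels
from the total length, leaving the distance of the right centers plus `2π - (β - α)`; that distance
is at most `d + (β - α)`. This path serves when `1 - cos (β - α) ≤ d * sin α`, which makes its
initial turn at most `α`. Otherwise disjointness of the disks gives a left-straight-right path whose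
segment has heading `h ∈ [α, π]`, and `sub_sin_le_mul_one_sub_cos` pays for its extra turning with
the shortfall `d * (1 - cos h)`. -/

theorem dist_cos_sin_le (a b : ℝ) :
    dist (!₂[cos a, sin a] : EuclideanSpace ℝ (Fin 2)) !₂[cos b, sin b] ≤ |a - b| := by
  rw [EuclideanSpace.dist_eq, ← sqrt_sq_eq_abs]
  apply sqrt_le_sqrt
  simp only [Fin.sum_univ_two, Real.dist_eq, sq_abs, Matrix.cons_val_zero, Matrix.cons_val_one]
  have h := one_sub_sq_div_two_le_cos (x := a - b)
  rw [cos_sub] at h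
  nlinarith [sin_sq_add_cos_sq a, sin_sq_add_cos_sq b]

/-- A `1`-Lipschitz heading function whose tangent integrates to the right displacement yields a
bounded-curvature path. -/
theorem mem_pathLengths_of_heading {x y α x' y' β L : ℝ} (hL : 0 ≤ L) {θ : ℝ → ℝ}
    (hθ : LipschitzWith 1 θ) (h0 : θ 0 = α) (hc : cos (θ L) = cos β) (hs : sin (θ L) = sin β)
    (hx : ∫ t in (0 : ℝ)..L, cos (θ t) = x' - x) (hy : ∫ t in (0 : ℝ)..L, sin (θ t) = y' - y) :
    L ∈ pathLengths (.of x y α) (.of x' y' β) := by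
  have cc : Continuous fun t => cos (θ t) := continuous_cos.comp hθ.continuous
  have cs : Continuous fun t => sin (θ t) := continuous_sin.comp hθ.continuous
  refine ⟨fun t => !₂[x + ∫ u in (0 : ℝ)..t, cos (θ u), y + ∫ u in (0 : ℝ)..t, sin (θ u)],
    hL, fun t => !₂[cos (θ t), sin (θ t)], ?_, ?_, ?_, ?_, ?_, ?_, ?_⟩
  · intro t _
    rw [hasDerivWithinAt_iff_hasFDerivWithinAt, hasFDerivWithinAt_euclidean]
    intro i
    fin_cases i
    · have := ((cc.integral_hasStrictDerivAt 0 t).hasDerivAt.const_add x).hasDerivWithinAt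
        (s := Icc 0 L)
      refine this.hasFDerivWithinAt.congr_fderiv ?_
      ext; simp
    · have := ((cs.integral_hasStrictDerivAt 0 t).hasDerivAt.const_add y).hasDerivWithinAt
        (s := Icc 0 L)
      refine this.hasFDerivWithinAt.congr_fderiv ?_
      ext; simp
  · intro t _
    simp [EuclideanSpace.norm_eq, Fin.sum_univ_two]
  · refine LipschitzWith.lipschitzOnWith (LipschitzWith.of_dist_le_mul fun s t => ?_)
    refine (dist_cos_sin_le _ _).trans ?_
    simpa [Real.dist_eq] using hθ.dist_le_mul s t
  · simp [Configuration.of]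
  · simp [Configuration.of, Configuration.dir, h0]
  · simp [Configuration.of, hx, hy]
  · simp [Configuration.of, Configuration.dir, hc, hs]

/-- The heading of a path that turns with rate `ε` during time `a`, runs straight during time `s`
and then turns with rate `δ`. -/
noncomputable def arcLineArcHeading (α ε δ a s t : ℝ) : ℝ :=
  α + ε * min t a + δ * max 0 (t - a - s)

theorem lipschitzWith_arcLineArcHeading {α ε δ a s : ℝ} (hε : |ε| = 1) (hδ : |δ| = 1)
    (hs : 0 ≤ s) : LipschitzWith 1 (arcLineArcHeading α ε δ a s) := by
  refine LipschitzWith.of_dist_le_mul fun t u => ?_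
  rw [Real.dist_eq, Real.dist_eq, NNReal.coe_one, one_mul]
  -- Since `0 ≤ s`, the two turns occupy non-overlapping time intervals, so their increments share
  -- `|t - u|`.
  have key : |min t a - min u a| + |max 0 (t - a - s) - max 0 (u - a - s)| ≤ |t - u| := by
    grind
  refine le_trans ?_ key
  have : arcLineArcHeading α ε δ a s t - arcLineArcHeading α ε δ a s u =
      ε * (min t a - min u a) + δ * (max 0 (t - a - s) - max 0 (u - a - s)) := by
    unfold arcLineArcHeading; ring
  rw [this]
  refine (abs_add_le _ _).trans ?_
  rw [abs_mul, abs_mul, hε, hδ, one_mul, one_mul]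

theorem integral_comp_arcLineArcHeading {α ε δ a s b : ℝ} (hε : |ε| = 1) (hδ : |δ| = 1)
    (ha : 0 ≤ a) (hs : 0 ≤ s) (hb : 0 ≤ b) {f F : ℝ → ℝ} (hf : Continuous f)
    (hF : ∀ t, HasDerivAt F (f t) t) :
    ∫ t in (0 : ℝ)..(a + s + b), f (arcLineArcHeading α ε δ a s t) =
      ε * (F (α + ε * a) - F α) + s * f (α + ε * a) +
        δ * (F (α + ε * a + δ * b) - F (α + ε * a)) := by
  have hε' : ε * ε = 1 := by rw [← abs_mul_abs_self, hε, one_mul]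
  have hδ' : δ * δ = 1 := by rw [← abs_mul_abs_self, hδ, one_mul]
  have hcont : Continuous fun t => f (arcLineArcHeading α ε δ a s t) :=
    hf.comp (lipschitzWith_arcLineArcHeading hε hδ hs).continuous
  rw [← intervalIntegral.integral_add_adjacent_intervals (hcont.intervalIntegrable 0 (a + s))
    (hcont.intervalIntegrable _ _), ← intervalIntegral.integral_add_adjacent_intervals
    (hcont.intervalIntegrable 0 a) (hcont.intervalIntegrable _ _)]
  have arc : ∀ κ c k p q : ℝ, κ * κ = 1 →
      ∫ t in p..q, f (c + κ * (t - k)) = κ * (F (c + κ * (q - k)) - F (c + κ * (p - k))) := by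
    intro κ c k p q hκ
    rw [mul_sub]
    refine intervalIntegral.integral_eq_sub_of_hasDerivAt
      (f := fun t => κ * F (c + κ * (t - k))) (fun t _ => ?_) ?_
    · have h1 : HasDerivAt (fun t => c + κ * (t - k)) κ t := by
        simpa using (((hasDerivAt_id t).sub_const k).const_mul κ).const_add c
      have h2 := ((hF (c + κ * (t - k))).comp t h1).const_mul κ
      refine h2.congr_deriv ?_
      linear_combination f (c + κ * (t - k)) * hκ
    · exact Continuous.intervalIntegrable (by fun_prop) _ _
  have e1 : ∫ t in (0 : ℝ)..a, f (arcLineArcHeading α ε δ a s t) =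
      ε * (F (α + ε * a) - F α) := by
    have := arc ε α 0 0 a hε'
    simp only [sub_zero, mul_zero, add_zero] at this
    rw [← this]
    refine intervalIntegral.integral_congr fun t ht => ?_
    rw [uIcc_of_le ha] at ht
    simp only [arcLineArcHeading]
    rw [min_eq_left ht.2, max_eq_left (by linarith [ht.2]), mul_zero, add_zero]
  have e2 : ∫ t in a..(a + s), f (arcLineArcHeading α ε δ a s t) = s * f (α + ε * a) := by
    have : ∫ t in a..(a + s), f (arcLineArcHeading α ε δ a s t) =
        ∫ _ in a..(a + s), f (α + ε * a) := by
      refine intervalIntegral.integral_congr fun t ht => ?_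
      rw [uIcc_of_le (by linarith)] at ht
      simp only [arcLineArcHeading]
      rw [min_eq_right ht.1, max_eq_left (by linarith [ht.2]), mul_zero, add_zero]
    rw [this]; simp
  have e3 : ∫ t in (a + s)..(a + s + b), f (arcLineArcHeading α ε δ a s t) =
      δ * (F (α + ε * a + δ * b) - F (α + ε * a)) := by
    have := arc δ (α + ε * a) (a + s) (a + s) (a + s + b) hδ'
    simp only [sub_self, mul_zero, add_zero, add_sub_cancel_left] at this
    rw [← this]
    refine intervalIntegral.integral_congr fun t ht => ?_
    rw [uIcc_of_le (by linarith)] at ht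
    simp only [arcLineArcHeading]
    rw [min_eq_right (by linarith [ht.1]), max_eq_right (by linarith [ht.1])]
    ring_nf
  rw [e1, e2, e3]

/-- Existence of a path made of an arc of length `a`, a segment of length `s` and an arc of
length `b`, given that its end configuration is the right one. -/
theorem mem_pathLengths_of_arcLineArc {x y α x' y' β ε δ a s b : ℝ} (hε : |ε| = 1)
    (hδ : |δ| = 1) (ha : 0 ≤ a) (hs : 0 ≤ s) (hb : 0 ≤ b)
    (hcos : cos (α + ε * a + δ * b) = cos β) (hsin : sin (α + ε * a + δ * b) = sin β)
    (hx : ε * (sin (α + ε * a) - sin α) + s * cos (α + ε * a) +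
      δ * (sin β - sin (α + ε * a)) = x' - x)
    (hy : ε * (cos α - cos (α + ε * a)) + s * sin (α + ε * a) +
      δ * (cos (α + ε * a) - cos β) = y' - y) :
    a + s + b ∈ pathLengths (.of x y α) (.of x' y' β) := by
  have hend : arcLineArcHeading α ε δ a s (a + s + b) = α + ε * a + δ * b := by
    unfold arcLineArcHeading
    rw [min_eq_right (by linarith), max_eq_right (by linarith)]
    ring
  refine mem_pathLengths_of_heading (by positivity)
    (lipschitzWith_arcLineArcHeading hε hδ hs) ?_ (by rw [hend, hcos]) (by rw [hend, hsin]) ?_ ?_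
  · unfold arcLineArcHeading
    rw [min_eq_left ha, max_eq_left (by linarith)]
    ring
  · rw [integral_comp_arcLineArcHeading hε hδ ha hs hb continuous_cos hasDerivAt_sin, hsin, hx]
  · rw [integral_comp_arcLineArcHeading (F := fun t => -cos t) hε hδ ha hs hb continuous_sin
      (fun t => (hasDerivAt_cos t).neg.congr_deriv (neg_neg _)), hcos, ← hy]
    ring

/-! ### Lower bound -/

open InnerProductGeometry in
-- Unit vectors at angle `φ` span a chord of length `2 sin (φ / 2)`.
theorem angle_le_two_mul_arcsin {V : Type*} [NormedAddCommGroup V] [InnerProductSpace ℝ V]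
    {x y : V} (hx : ‖x‖ = 1) (hy : ‖y‖ = 1) {h : ℝ} (hxy : ‖x - y‖ ≤ h) (h2 : h ≤ 2) :
    angle x y ≤ 2 * arcsin (h / 2) := by
  have h0 : 0 ≤ h := (norm_nonneg _).trans hxy
  have hs : sin (angle x y / 2) ≤ h / 2 := by
    have e := norm_sub_sq_real x y
    have e2 : inner ℝ x y = cos (angle x y) := by
      rw [cos_angle, hx, hy]; simp
    rw [hx, hy, e2] at e
    have e3 : cos (angle x y) = 1 - 2 * sin (angle x y / 2) ^ 2 := by
      have := cos_two_mul' (angle x y / 2)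
      rw [mul_div_cancel₀ _ (two_ne_zero)] at this
      nlinarith [sin_sq_add_cos_sq (angle x y / 2)]
    have h3 : ‖x - y‖ ^ 2 ≤ h ^ 2 := by gcongr
    refine le_of_sq_le_sq ?_ (by positivity)
    nlinarith
  have := (le_arcsin_iff_sin_le ⟨?_, ?_⟩ ⟨?_, ?_⟩).2 hs <;>
    linarith [angle_nonneg x y, angle_le_pi x y, pi_pos]

open InnerProductGeometry Filter Topology in
/-- A `1`-Lipschitz curve on the unit sphere is `1`-Lipschitz for the angular distance. -/
theorem angle_le_of_lipschitzOnWith_one {V : Type*} [NormedAddCommGroup V]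
    [InnerProductSpace ℝ V] {v : ℝ → V} {s : Set ℝ} (hs : s.OrdConnected)
    (hv : LipschitzOnWith 1 v s) (hn : ∀ t ∈ s, ‖v t‖ = 1) {a b : ℝ} (ha : a ∈ s) (hb : b ∈ s)
    (hab : a ≤ b) : angle (v a) (v b) ≤ b - a := by
  set h := b - a with hh
  have h0 : 0 ≤ h := sub_nonneg.2 hab
  -- Cut `[a, b]` into `n` equal pieces, apply the chord estimate to each, and add by the triangle
  -- inequality for angles.
  have step : ∀ n : ℕ, 0 < n → h / n ≤ 2 → angle (v a) (v b) ≤ n * (2 * arcsin (h / n / 2)) := by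
    intro n hn0 hn2
    have hn' : (0 : ℝ) < n := by exact_mod_cast hn0
    have hm : ∀ k : ℕ, k ≤ n → a + k * (h / n) ∈ s := by
      intro k hk
      refine hs.out ha hb ⟨by have : 0 ≤ k * (h / n) := by positivity
                              linarith, ?_⟩
      have hk' : (k : ℝ) ≤ n := by exact_mod_cast hk
      have : k * (h / n) ≤ n * (h / n) := by gcongr
      rw [mul_div_cancel₀ _ hn'.ne'] at this
      linarith
    have ind : ∀ k : ℕ, k ≤ n →
        angle (v a) (v (a + k * (h / n))) ≤ k * (2 * arcsin (h / n / 2)) := by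
      intro k
      induction k with
      | zero =>
        intro _
        have : v a ≠ 0 := fun h' => by simpa [h'] using hn a ha
        simp [angle_self this]
      | succ k ih =>
        intro hk
        have h1 := ih (by omega)
        have m1 := hm k (by omega)
        have m2 := hm (k + 1) hk
        have h2 : angle (v (a + k * (h / n))) (v (a + (k + 1 : ℕ) * (h / n))) ≤
            2 * arcsin (h / n / 2) := by
          refine angle_le_two_mul_arcsin (hn _ m1) (hn _ m2) ?_ hn2
          have := hv.dist_le_mul _ m1 _ m2
          rw [dist_eq_norm, Real.dist_eq] at this
          refine this.trans (le_of_eq ?_)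
          have hx : a + k * (h / n) - (a + (k + 1 : ℕ) * (h / n)) = -(h / n) := by
            push_cast; ring
          rw [hx, abs_neg, abs_of_nonneg (by positivity)]
          simp
        have := angle_le_angle_add_angle (v a) (v (a + k * (h / n)))
          (v (a + (k + 1 : ℕ) * (h / n)))
        push_cast at *
        linarith
    have := ind n le_rfl
    rwa [mul_div_cancel₀ _ hn'.ne', hh, add_sub_cancel, ← hh] at this
  -- The difference quotient of this function at `0` with increment `1 / n` is the bound in `step`,
  -- which therefore tends to `h`.
  have hd : HasDerivAt (fun x : ℝ => 2 * arcsin (x * (h / 2))) h 0 := by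
    have h1 : HasDerivAt (fun x : ℝ => x * (h / 2)) (h / 2) 0 := by
      simpa using (hasDerivAt_id (0 : ℝ)).mul_const (h / 2)
    have h2 : HasDerivAt arcsin 1 (0 * (h / 2)) := by
      simpa using hasDerivAt_arcsin (x := 0 * (h / 2)) (by simp) (by simp)
    have := (h2.comp 0 h1).const_mul 2
    rw [one_mul, mul_div_cancel₀ _ two_ne_zero] at this
    exact this
  have lim : Tendsto (fun n : ℕ => (n : ℝ) * (2 * arcsin (h / n / 2))) atTop (𝓝 h) := by
    have t1 : Tendsto (fun n : ℕ => ((n : ℝ))⁻¹) atTop (𝓝[≠] 0) := by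
      refine tendsto_nhdsWithin_iff.2 ⟨tendsto_inv_atTop_nhds_zero_nat, ?_⟩
      filter_upwards [eventually_gt_atTop 0] with n hn
      simp; omega
    have := hd.tendsto_slope_zero.comp t1
    refine this.congr fun n => ?_
    simp only [Function.comp, smul_eq_mul, inv_inv, zero_add, zero_mul, arcsin_zero, mul_zero,
      sub_zero]
    congr 3
    ring
  refine ge_of_tendsto lim ?_
  have t2 : Tendsto (fun n : ℕ => h / n) atTop (𝓝 0) := tendsto_const_div_atTop_nhds_zero_nat h
  filter_upwards [eventually_gt_atTop 0, t2.eventually (ge_mem_nhds (zero_lt_two))] with n h1 h2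
  exact step n h1 h2

open InnerProductGeometry in
theorem cos_le_inner_of_lipschitzOnWith_one {V : Type*} [NormedAddCommGroup V]
    [InnerProductSpace ℝ V] {v : ℝ → V} {s : Set ℝ} (hs : s.OrdConnected)
    (hv : LipschitzOnWith 1 v s) (hn : ∀ t ∈ s, ‖v t‖ = 1) {a b : ℝ} (ha : a ∈ s) (hb : b ∈ s)
    (hab : a ≤ b) (hpi : b - a ≤ π) : cos (b - a) ≤ inner ℝ (v a) (v b) := by
  have h := cos_le_cos_of_nonneg_of_le_pi (angle_nonneg (v a) (v b)) hpi
    (angle_le_of_lipschitzOnWith_one hs hv hn ha hb hab)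
  rwa [cos_angle, hn a ha, hn b hb, mul_one, div_one] at h

theorem sub_le_of_hasDerivWithinAt_nonpos {f f' : ℝ → ℝ} {a b : ℝ} (hab : a ≤ b)
    (hf : ∀ t ∈ Icc a b, HasDerivWithinAt f (f' t) (Icc a b) t)
    (hf' : ∀ t ∈ Icc a b, f' t ≤ 0) : f b ≤ f a := by
  have : AntitoneOn f (Icc a b) := by
    refine antitoneOn_of_hasDerivWithinAt_nonpos (f' := f') (convex_Icc a b)
      (fun t ht => (hf t ht).continuousWithinAt) (fun t ht => ?_)
      (fun t ht => hf' t (interior_subset ht))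
    exact (hf t (interior_subset ht)).mono interior_subset
  exact this (left_mem_Icc.2 hab) (right_mem_Icc.2 hab) hab

/-- A path that starts and ends with heading `π` and moves in direction `0` by `d` has length at
least `d + 2π`. -/
theorem add_two_pi_le_of_mem_pathLengths {d L : ℝ} (hd : 0 < d)
    (hL : L ∈ pathLengths (.of 0 0 π) (.of d 0 π)) : d + 2 * π ≤ L := by
  obtain ⟨γ, hL0, v, hγ, hn, hv, g0, v0, gL, vL⟩ := hL
  have hγ0 : ∀ t ∈ Icc 0 L, HasDerivWithinAt (fun t => γ t 0) (v t 0) (Icc 0 L) t := by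
    intro t ht
    have := (hasFDerivWithinAt_euclidean.1 (hγ t ht).hasFDerivWithinAt 0).hasDerivWithinAt
    simpa using this
  have x0 : γ 0 0 = 0 := by simp [g0, Configuration.of]
  have xL : γ L 0 = d := by simp [gL, Configuration.of]
  have m0 : (0 : ℝ) ∈ Icc 0 L := left_mem_Icc.2 hL0
  have mL : L ∈ Icc 0 L := right_mem_Icc.2 hL0
  -- The end directions are both `(-1, 0)`, so the inner product with them is minus the first
  -- coordinate.
  have bound0 : ∀ t ∈ Icc 0 L, t ≤ π → v t 0 ≤ -cos t := by
    intro t ht htp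
    have := cos_le_inner_of_lipschitzOnWith_one ordConnected_Icc hv hn m0 ht ht.1 (by simpa)
    simp [v0, Configuration.dir, Configuration.of, PiLp.inner_apply, Fin.sum_univ_two] at this
    linarith
  have boundL : ∀ t ∈ Icc 0 L, L - t ≤ π → v t 0 ≤ -cos (L - t) := by
    intro t ht htp
    have := cos_le_inner_of_lipschitzOnWith_one ordConnected_Icc hv hn ht mL ht.2 htp
    simp [vL, Configuration.dir, Configuration.of, PiLp.inner_apply, Fin.sum_univ_two] at this
    linarith
  have bound1 : ∀ t ∈ Icc 0 L, v t 0 ≤ 1 := by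
    intro t ht
    have := PiLp.norm_apply_le (v t) 0
    rw [hn t ht] at this
    exact (le_abs_self _).trans this
  have first : ∀ t ∈ Icc 0 L, t ≤ π → γ t 0 ≤ -sin t := by
    intro t ht htp
    have sub : Icc 0 t ⊆ Icc 0 L := Icc_subset_Icc_right ht.2
    have := sub_le_of_hasDerivWithinAt_nonpos (f := fun u => γ u 0 + sin u)
      (f' := fun u => v u 0 + cos u) ht.1
      (fun u hu => ((hγ0 u (sub hu)).mono sub).add (hasDerivAt_sin u).hasDerivWithinAt)
      (fun u hu => by linarith [bound0 u (sub hu) (hu.2.trans htp)])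
    simp only [x0, sin_zero] at this
    linarith
  have last : ∀ t ∈ Icc 0 L, L - t ≤ π → d - γ t 0 ≤ -sin (L - t) := by
    intro t ht htp
    have sub : Icc t L ⊆ Icc 0 L := Icc_subset_Icc_left ht.1
    have := sub_le_of_hasDerivWithinAt_nonpos (f := fun u => γ u 0 - sin (L - u))
      (f' := fun u => v u 0 + cos (L - u)) ht.2
      (fun u hu => by
        have h1 : HasDerivAt (fun u => sin (L - u)) (-cos (L - u)) u := by
          simpa using ((hasDerivAt_id u).const_sub L).sin
        exact (((hγ0 u (sub hu)).mono sub).sub h1.hasDerivWithinAt).congr_deriv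
          (sub_neg_eq_add _ _))
      (fun u hu => by linarith [boundL u (sub hu) (by linarith [hu.1])])
    simp only [xL, sub_self, sin_zero] at this
    linarith
  -- If `L < 2π`, the two estimates meet at the midpoint and give `d ≤ -2 sin (L / 2) ≤ 0`.
  by_cases hLp : L < 2 * π
  · have m : L / 2 ∈ Icc 0 L := ⟨by linarith, by linarith⟩
    have h1 := first _ m (by linarith)
    have h2 := last _ m (by linarith)
    have h3 : 0 ≤ sin (L / 2) := sin_nonneg_of_nonneg_of_le_pi m.1 (by linarith)
    rw [sub_half] at h2
    linarith
  · have hp := pi_pos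
    have h1 := first π ⟨hp.le, by linarith⟩ le_rfl
    have h2 := last (L - π) ⟨by linarith, by linarith⟩ (by linarith)
    have sub : Icc π (L - π) ⊆ Icc 0 L := Icc_subset_Icc hp.le (by linarith)
    have h3 := sub_le_of_hasDerivWithinAt_nonpos (f := fun u => γ u 0 - u)
      (f' := fun u => v u 0 - 1) (by linarith)
      (fun u hu => ((hγ0 u (sub hu)).mono sub).sub (hasDerivWithinAt_id u _))
      (fun u hu => by linarith [bound1 u (sub hu)])
    simp only [sin_pi, sub_sub_cancel] at h1 h2
    linarith

/-! ### Upper bound -/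

/-- The last clause fixes the direction of the zero vector: when the two right disks coincide, the
heading `0` still lies in `[0, α]`. -/
theorem exists_polar (a b : ℝ) : ∃ h, -π < h ∧ h ≤ π ∧
    √(a ^ 2 + b ^ 2) * cos h = a ∧ √(a ^ 2 + b ^ 2) * sin h = b ∧
    (√(a ^ 2 + b ^ 2) = 0 → h = 0) := by
  have hn : ‖(⟨a, b⟩ : ℂ)‖ = √(a ^ 2 + b ^ 2) := Complex.norm_eq_sqrt_sq_add_sq _
  refine ⟨Complex.arg ⟨a, b⟩, Complex.neg_pi_lt_arg _, Complex.arg_le_pi _, ?_, ?_, fun h0 => ?_⟩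
  · rw [← hn, Complex.norm_mul_cos_arg]
  · rw [← hn, Complex.norm_mul_sin_arg]
  · rw [← hn, norm_eq_zero] at h0
    rw [h0, Complex.arg_zero]

/-- If a right-straight-right path with initial right turn of angle at most `α` exists, it is
short enough. -/
theorem exists_pathLength_le_of_rightStraightRight {d α β : ℝ} (hd : 0 < d)
    (hΔ : (α, β) ∈ triangleDelta) (hg : 1 - cos (β - α) ≤ d * sin α) :
    ∃ L ∈ pathLengths (.of 0 0 α) (.of d 0 β), L ≤ d + 2 * π := by
  obtain ⟨hα0, hαπ, hαβ, hβ⟩ : 0 ≤ α ∧ α ≤ π ∧ α ≤ β ∧ β ≤ 2 * π - α := hΔ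
  obtain ⟨h, hh1, hh2, e1, e2, hz⟩ := exists_polar (d + sin β - sin α) (cos α - cos β)
  set s := √((d + sin β - sin α) ^ 2 + (cos α - cos β) ^ 2) with hs
  have hs0 : 0 ≤ s := sqrt_nonneg _
  have hcos : cos β ≤ cos α := by
    rcases le_total β π with hb | hb
    · exact cos_le_cos_of_nonneg_of_le_pi hα0 hb hαβ
    · rw [← cos_two_pi_sub β]
      exact cos_le_cos_of_nonneg_of_le_pi hα0 (by linarith) (by linarith)
  have hh0 : 0 ≤ h := by
    by_contra! hneg
    have hsin := sin_neg_of_neg_of_neg_pi_lt hneg hh1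
    have : s ≠ 0 := fun h' => hneg.ne (hz h')
    have : 0 < s := lt_of_le_of_ne hs0 this.symm
    nlinarith
  have hhα : h ≤ α := by
    by_contra! hlt
    have : s ≠ 0 := fun h' => by linarith [hz h']
    have hspos : 0 < s := lt_of_le_of_ne hs0 this.symm
    -- This is the leftward offset of the final right center from the initial one, relative to the
    -- heading `α`.
    have hle : s * sin (h - α) ≤ 0 := by
      have : s * sin (h - α) = 1 - cos (β - α) - d * sin α := by
        rw [sin_sub, cos_sub]
        linear_combination cos α * e2 - sin α * e1 + sin_sq_add_cos_sq α
      linarith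
    have hsin : sin (h - α) ≤ 0 := by
      by_contra! hp
      nlinarith [mul_pos hspos hp]
    have hπ : π ≤ h - α := by
      by_contra! hp
      linarith [sin_pos_of_pos_of_lt_pi (sub_pos.2 hlt) hp]
    have hα : α = 0 := by linarith
    have hhπ : h = π := by linarith
    subst hα
    rw [hhπ, cos_pi] at e1
    simp only [sub_zero, sin_zero, mul_zero, tsub_le_iff_right, zero_add] at hg e1
    have : sin β = 0 := by
      have := sin_sq_add_cos_sq β
      nlinarith [cos_le_one β]
    linarith
  have hsle : s ≤ d + (β - α) := by
    refine (sqrt_le_iff).2 ⟨by linarith, ?_⟩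
    have h1 := one_sub_sq_div_two_le_cos (x := β - α)
    have h2 : sin β - sin α ≤ β - α := by
      have := (abs_le.1 (abs_sin_sub_sin_le β α)).2
      rwa [abs_of_nonneg (by linarith)] at this
    rw [cos_sub] at h1
    nlinarith [sin_sq_add_cos_sq α, sin_sq_add_cos_sq β]
  -- The final right turn goes from `h` down to `β - 2π`, so its length is nonnegative even if `h <
  -- β`.
  refine ⟨(α - h) + s + (h - β + 2 * π), ?_, by linarith⟩
  have harg : α + -1 * (α - h) = h := by ring
  have hend : h + -1 * (h - β + 2 * π) = β - 2 * π := by ring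
  refine mem_pathLengths_of_arcLineArc (ε := -1) (δ := -1) (by simp) (by simp) (by linarith) hs0
    (by linarith) ?_ ?_ ?_ ?_
  · rw [harg, hend, cos_sub_two_pi]
  · rw [harg, hend, sin_sub_two_pi]
  · rw [harg]; linear_combination e1
  · rw [harg]; linear_combination e2

/-- With `a = 2x` and `h = 2y` the hypothesis reads `sin² x ≤ d sin y cos y`. Multiplying by `tan x
≤ tan y` gives `tan x - sin x cos x ≤ d sin² y`, and `x ≤ tan x` concludes. -/
theorem sub_sin_le_mul_one_sub_cos {a h d : ℝ} (ha : 0 ≤ a) (hah : a ≤ h) (hh : h ≤ π)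
    (hd : 0 < d) (hle : 1 - cos a ≤ d * sin h) : a - sin a ≤ d * (1 - cos h) := by
  rcases hh.eq_or_lt with rfl | hlt
  · rw [sin_pi, mul_zero] at hle
    have hc : cos a = 1 := le_antisymm (cos_le_one a) (by linarith)
    have : a = 0 := (cos_eq_one_iff_of_lt_of_lt (by linarith [pi_pos])
      (by linarith [pi_pos])).1 hc
    subst this
    rw [sin_zero, cos_pi]; linarith
  obtain ⟨x, rfl⟩ : ∃ x, a = 2 * x := ⟨a / 2, by ring⟩
  obtain ⟨y, rfl⟩ : ∃ y, h = 2 * y := ⟨h / 2, by ring⟩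
  have hcx : 0 < cos x := cos_pos_of_mem_Ioo ⟨by linarith [pi_pos], by linarith⟩
  have hcy : 0 < cos y := cos_pos_of_mem_Ioo ⟨by linarith [pi_pos], by linarith⟩
  have htan : tan x ≤ tan y := by
    rcases (show x ≤ y by linarith).eq_or_lt with rfl | hxy
    · exact le_rfl
    · exact (tan_lt_tan_of_nonneg_of_lt_pi_div_two (by linarith) (by linarith) hxy).le
  have htx : x ≤ tan x := le_tan (by linarith) (by linarith)
  have hx0 : 0 ≤ tan x := by linarith
  have ex : tan x * cos x = sin x := tan_mul_cos hcx.ne'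
  have ey : tan y * cos y = sin y := tan_mul_cos hcy.ne'
  rw [sin_two_mul, cos_two_mul'] at *
  have h1 : sin x ^ 2 ≤ d * sin y * cos y := by nlinarith [sin_sq_add_cos_sq x]
  have h2 : sin x ^ 2 * tan x ≤ d * sin y * cos y * tan y := by
    gcongr
    exact (sq_nonneg _).trans h1
  have h3 : d * sin y * cos y * tan y = d * sin y ^ 2 := by
    linear_combination d * sin y * ey
  have h4 : sin x ^ 2 * tan x = tan x - sin x * cos x := by
    linear_combination tan x * sin_sq_add_cos_sq x - cos x * ex
  nlinarith [sin_sq_add_cos_sq y]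

theorem dLR_sq (d α β : ℝ) :
    dLR d α β ^ 2 = (d + sin α + sin β) ^ 2 + (cos α + cos β) ^ 2 := by
  rw [dLR, EuclideanSpace.dist_eq, sq_sqrt (by positivity)]
  simp only [Configuration.leftCenter, Configuration.rightCenter, Configuration.of,
    Fin.sum_univ_two, Real.dist_eq, sq_abs]
  simp
  ring

/-- In case C, if the center of the right disk at the end is not reached by the initial right
turn, then the initial direction points towards the separating tangent. -/
theorem mul_cos_add_sin_nonneg {d α β : ℝ} (hd : 0 < d) (hΔ : (α, β) ∈ triangleDelta)
    (hg : d * sin α < 1 - cos (β - α)) (hC : 2 ≤ dLR d α β) :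
    0 ≤ d * cos α + sin (β - α) := by
  obtain ⟨hα0, hαπ, hαβ, hβ⟩ : 0 ≤ α ∧ α ≤ π ∧ α ≤ β ∧ β ≤ 2 * π - α := hΔ
  by_contra! hneg
  have hsα := sin_nonneg_of_nonneg_of_le_pi hα0 hαπ
  have hdsα : 0 ≤ d * sin α := by positivity
  -- For `β - α ≤ π`, weighting `hneg` by `sin w` and `hg` by `cos w` gives `d * sin (α + w) < 0`,
  -- which is absurd.
  rcases le_total (β - α) π with hu | hu
  · obtain ⟨w, rfl⟩ : ∃ w, β = α + 2 * w := ⟨(β - α) / 2, by ring⟩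
    rw [add_sub_cancel_left] at *
    rw [cos_two_mul'] at hg
    rw [sin_two_mul] at hneg
    have hsw := sin_nonneg_of_nonneg_of_le_pi (x := w) (by linarith) (by linarith)
    have hsw' : 0 < sin w := by
      refine lt_of_le_of_ne hsw fun h0 => ?_
      have := sin_sq_add_cos_sq w
      rw [← h0] at hg this
      nlinarith
    have hcw : 0 ≤ cos w := cos_nonneg_of_mem_Icc ⟨by linarith [pi_pos], by linarith⟩
    have hsum := sin_nonneg_of_nonneg_of_le_pi (x := α + w) (by linarith) (by linarith)
    rw [sin_add] at hsum
    have h1 := mul_lt_mul_of_pos_left hneg hsw'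
    have h2 := mul_le_mul_of_nonneg_left hg.le hcw
    have h3 := mul_nonneg hd.le hsum
    nlinarith [sin_sq_add_cos_sq w]
  -- Here `β ≤ 2π - α` means `α ≤ w`. The inequalities `hg` and `hneg` yield `d² < 4 sin² w`, which
  -- forces `dLR` below `2`.
  · obtain ⟨w, rfl⟩ : ∃ w, β = α - 2 * w + 2 * π := ⟨π - (β - α) / 2, by ring⟩
    have e : α - 2 * w + 2 * π - α = 2 * π - 2 * w := by ring
    rw [e] at hg hneg hu
    rw [cos_two_pi_sub, cos_two_mul'] at hg
    rw [sin_two_pi_sub, sin_two_mul] at hneg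
    have hsw := sin_nonneg_of_nonneg_of_le_pi (x := w) (by linarith) (by linarith)
    have hcw : 0 ≤ cos w := cos_nonneg_of_mem_Icc ⟨by linarith [pi_pos], by linarith⟩
    have hcα : 0 ≤ cos α := cos_nonneg_of_mem_Icc ⟨by linarith [pi_pos], by linarith⟩
    have hC2 : 2 ^ 2 ≤ dLR d α (α - 2 * w + 2 * π) ^ 2 := by gcongr
    rw [dLR_sq, sin_add_two_pi, cos_add_two_pi, sin_sub, cos_sub] at hC2
    have hsub := sin_nonneg_of_nonneg_of_le_pi (x := w - α) (by linarith) (by linarith)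
    have hdc : 0 ≤ d * cos α := by positivity
    have h1 : (d * sin α) ^ 2 + (d * cos α) ^ 2 < 4 * sin w ^ 2 := by
      have p1 : (d * sin α) ^ 2 < (2 * sin w ^ 2) ^ 2 :=
        pow_lt_pow_left₀ (by linarith [sin_sq_add_cos_sq w]) hdsα two_ne_zero
      have p2 : (d * cos α) ^ 2 < (2 * sin w * cos w) ^ 2 :=
        pow_lt_pow_left₀ (by linarith) hdc two_ne_zero
      calc _ < (2 * sin w ^ 2) ^ 2 + (2 * sin w * cos w) ^ 2 := add_lt_add p1 p2
        _ = 4 * sin w ^ 2 := by linear_combination 4 * sin w ^ 2 * sin_sq_add_cos_sq w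
    have h2 : d ^ 2 < 4 * sin w ^ 2 := by
      calc d ^ 2 = (d * sin α) ^ 2 + (d * cos α) ^ 2 := by
            linear_combination -d ^ 2 * sin_sq_add_cos_sq α
        _ < _ := h1
    have h3 : (d + sin α + (sin α * cos (2 * w) - cos α * sin (2 * w))) ^ 2 +
        (cos α + (cos α * cos (2 * w) + sin α * sin (2 * w))) ^ 2 =
        d ^ 2 - 4 * (d * cos w * sin (w - α)) + 4 - 4 * sin w ^ 2 := by
      rw [sin_sub, cos_two_mul, sin_two_mul, sin_sq w]
      have q1 := sin_sq w
      have q2 := sin_sq α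
      ring_nf
      simp only [q1, q2]
      ring
    rw [h3] at hC2
    have := mul_nonneg (mul_nonneg hd.le hcw) hsub
    linarith

/-- In case C, the left-straight-right path is short enough whenever the right-straight-right
path is not. -/
theorem exists_pathLength_le_of_leftStraightRight {d α β : ℝ} (hd : 0 < d)
    (hΔ : (α, β) ∈ triangleDelta) (hg : d * sin α < 1 - cos (β - α)) (hC : 2 ≤ dLR d α β) :
    ∃ L ∈ pathLengths (.of 0 0 α) (.of d 0 β), L ≤ d + 2 * π := by
  have hB := mul_cos_add_sin_nonneg hd hΔ hg hC
  obtain ⟨hα0, hαπ, hαβ, hβ⟩ : 0 ≤ α ∧ α ≤ π ∧ α ≤ β ∧ β ≤ 2 * π - α := hΔ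
  have hC2 : 2 ^ 2 ≤ dLR d α β ^ 2 := by gcongr
  rw [dLR_sq] at hC2
  obtain ⟨x, hx⟩ : ∃ x, x = d + sin α + sin β := ⟨_, rfl⟩
  obtain ⟨y, hy⟩ : ∃ y, y = -(cos α + cos β) := ⟨_, rfl⟩
  have hxy : 4 ≤ x ^ 2 + y ^ 2 := by rw [hx, hy]; linarith
  obtain ⟨s, hs0, hs⟩ : ∃ s, 0 ≤ s ∧ s ^ 2 + 4 = x ^ 2 + y ^ 2 :=
    ⟨√(x ^ 2 + y ^ 2 - 4), sqrt_nonneg _, by rw [sq_sqrt (by linarith)]; ring⟩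
  -- The inner tangent has length `s` and heading `h` with `x + iy = e^{ih} (s - 2i)`; the vector
  -- used here is `(x + iy)(s + 2i)`.
  obtain ⟨h, hh1, hh2, e1, e2, -⟩ := exists_polar (x * s - 2 * y) (2 * x + y * s)
  have hr : √((x * s - 2 * y) ^ 2 + (2 * x + y * s) ^ 2) = s ^ 2 + 4 := by
    rw [sqrt_eq_iff_eq_sq (by positivity) (by positivity)]
    linear_combination -(s ^ 2 + 4) * hs
  rw [hr] at e1 e2
  have hpos : s ^ 2 + 4 ≠ 0 := by positivity
  have E1 : s * cos h + 2 * sin h = d + sin α + sin β := by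
    rw [← hx]
    refine mul_left_cancel₀ hpos ?_
    linear_combination s * e1 + 2 * e2
  have E2 : s * sin h - 2 * cos h = -(cos α + cos β) := by
    rw [← hy]
    refine mul_left_cancel₀ hpos ?_
    linear_combination s * e2 - 2 * e1
  have F1 : s = d * cos h - sin (h - α) - sin (h - β) := by
    rw [sin_sub, sin_sub]
    linear_combination cos h * E1 + sin h * E2 - s * sin_sq_add_cos_sq h
  have F2 : d * sin h = (1 - cos (h - α)) + (1 - cos (h - β)) := by
    rw [cos_sub, cos_sub]
    linear_combination cos h * E2 - sin h * E1 + 2 * sin_sq_add_cos_sq h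
  have hh0 : 0 ≤ h := by
    by_contra! hneg
    have hsin := sin_neg_of_neg_of_neg_pi_lt hneg hh1
    nlinarith [cos_le_one (h - α), cos_le_one (h - β), mul_pos_of_neg_of_neg hsin (neg_lt_zero.2 hd)]
  have hαh : α ≤ h := by
    by_contra! hlt
    -- `G1` and `G2` bound the rightward and forward components, relative to the heading `α`, of the
    -- vector joining the two centers.
    have G1 : s * sin (α - h) + 2 * cos (α - h) < 2 := by
      have : s * sin (α - h) + 2 * cos (α - h) = d * sin α + 1 + cos (β - α) := by
        rw [sin_sub, cos_sub, cos_sub]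
        linear_combination sin α * E1 - cos α * E2 + sin_sq_add_cos_sq α
      linarith
    have G2 : 0 ≤ s * cos (α - h) - 2 * sin (α - h) := by
      have : s * cos (α - h) - 2 * sin (α - h) = d * cos α + sin (β - α) := by
        rw [sin_sub, cos_sub, sin_sub]
        linear_combination cos α * E1 + sin α * E2
      linarith
    have hsin := sin_nonneg_of_nonneg_of_le_pi (x := α - h) (by linarith) (by linarith)
    rcases le_or_gt (cos (α - h)) 0 with hc | hc
    · have hzero : sin (α - h) ≤ 0 := by
        have := mul_nonneg hs0 (neg_nonneg.2 hc)
        linarith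
      have hπ : π ≤ α - h := by
        by_contra! hp
        linarith [sin_pos_of_pos_of_lt_pi (sub_pos.2 hlt) hp]
      have hα : α = π := by linarith
      have hβ' : β = π := by linarith
      rw [hα, hβ'] at hg
      simp at hg
    · have p1 := mul_nonneg hsin G2
      have p2 := mul_lt_mul_of_pos_right G1 hc
      linarith [sin_sq_add_cos_sq (α - h), cos_le_one (α - h)]
  have ha0 : 0 ≤ sin (h - α) := sin_nonneg_of_nonneg_of_le_pi (by linarith) (by linarith)
  have hcd : d * cos h ≤ d := by nlinarith [cos_le_one h]
  have harg : α + 1 * (h - α) = h := by ring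
  rcases le_total β h with hβh | hβh
  · have hb0 : 0 ≤ sin (h - β) := sin_nonneg_of_nonneg_of_le_pi (by linarith) (by linarith)
    refine ⟨(h - α) + s + (h - β), ?_, by linarith⟩
    have hend : h + -1 * (h - β) = β := by ring
    refine mem_pathLengths_of_arcLineArc (ε := 1) (δ := -1) (by simp) (by simp) (by linarith)
      hs0 (by linarith) ?_ ?_ ?_ ?_
    · rw [harg, hend]
    · rw [harg, hend]
    · rw [harg]; linear_combination E1
    · rw [harg]; linear_combination E2
  -- The last turn now passes through an extra `2π`. By `F1` the length exceeds `d + 2π` by `(h - α)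
  -- - sin (h - α) - d (1 - cos h)` plus `sin (β - h) - (β - h) ≤ 0`.
  · have key := sub_sin_le_mul_one_sub_cos (a := h - α) (h := h) (d := d) (by linarith)
      (by linarith) hh2 hd (by linarith [cos_le_one (h - β)])
    have hb : sin (β - h) ≤ β - h := sin_le (by linarith)
    have hneg : sin (h - β) = -sin (β - h) := by rw [← sin_neg, neg_sub]
    refine ⟨(h - α) + s + (h - β + 2 * π), ?_, by linarith⟩
    have hend : h + -1 * (h - β + 2 * π) = β - 2 * π := by ring
    refine mem_pathLengths_of_arcLineArc (ε := 1) (δ := -1) (by simp) (by simp) (by linarith)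
      hs0 (by linarith) ?_ ?_ ?_ ?_
    · rw [harg, hend, cos_sub_two_pi]
    · rw [harg, hend, sin_sub_two_pi]
    · rw [harg]; linear_combination E1
    · rw [harg]; linear_combination E2

/-! ### Combination of the bounds and the extremal pair `(π, π)`. -/

theorem ell_le_of_mem_regionCDelta {d α β : ℝ} (hd : 0 < d) (h : (α, β) ∈ regionCDelta d) :
    ell d α β ≤ ((d + 2 * π : ℝ) : EReal) := by
  obtain ⟨L, hL, hle⟩ : ∃ L ∈ pathLengths (.of 0 0 α) (.of d 0 β), L ≤ d + 2 * π := by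
    rcases le_or_gt (1 - cos (β - α)) (d * sin α) with hg | hg
    · exact exists_pathLength_le_of_rightStraightRight hd h.1 hg
    · exact exists_pathLength_le_of_leftStraightRight hd h.1 hg h.2
  exact (iInf₂_le L hL).trans (EReal.coe_le_coe_iff.2 hle)

/-- A left half circle, a segment of length `d` on the line `y = -2`, and another left half circle.
-/
theorem add_two_pi_mem_pathLengths {d : ℝ} (hd : 0 < d) :
    d + 2 * π ∈ pathLengths (.of 0 0 π) (.of d 0 π) := by
  have e : d + 2 * π = π + d + π := by ring
  have h1 : π + 1 * π = 2 * π := by ring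
  have h2 : 2 * π + 1 * π = π + 2 * π := by ring
  rw [e]
  refine mem_pathLengths_of_arcLineArc (ε := 1) (δ := 1) (by simp) (by simp) pi_pos.le hd.le
    pi_pos.le ?_ ?_ ?_ ?_
  · rw [h1, h2, cos_add_two_pi]
  · rw [h1, h2, sin_add_two_pi]
  · rw [h1]; simp
  · rw [h1]; simp

theorem shortestLength_eq_of_isLeast {σ σ' : Configuration} {L : ℝ}
    (h : IsLeast (pathLengths σ σ') L) : shortestLength σ σ' = (L : EReal) :=
  le_antisymm (iInf₂_le L h.1) (le_iInf₂ fun _ hM => EReal.coe_le_coe_iff.2 (h.2 hM))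

theorem pi_pi_mem_regionCDelta (d : ℝ) : (π, π) ∈ regionCDelta d := by
  have hp := pi_pos.le
  refine ⟨⟨hp, le_rfl, le_rfl, by simp only; linarith⟩, ?_⟩
  refine le_of_sq_le_sq ?_ dist_nonneg
  simp only
  rw [dLR_sq, sin_pi, cos_pi]
  nlinarith [sq_nonneg d]

theorem mainTheorem5 (d : ℝ) (hd : 0 < d) :
    dubC d = ((2 * π : ℝ) : EReal) ∧
    (π, π) ∈ regionCDelta d ∧
    IsLeast (pathLengths (Configuration.of 0 0 π) (Configuration.of d 0 π)) (d + 2 * π) ∧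
    ((2 * π : ℝ) : EReal) ≤ dub d := by
  have hmem := pi_pi_mem_regionCDelta d
  have hleast : IsLeast (pathLengths (Configuration.of 0 0 π) (Configuration.of d 0 π))
      (d + 2 * π) :=
    ⟨add_two_pi_mem_pathLengths hd, fun _ hL => add_two_pi_le_of_mem_pathLengths hd hL⟩
  have hell := shortestLength_eq_of_isLeast hleast
  have hsub : ((d + 2 * π : ℝ) : EReal) - (d : EReal) = ((2 * π : ℝ) : EReal) := by
    rw [← EReal.coe_sub, add_sub_cancel_left]
  refine ⟨le_antisymm ?_ ?_, hmem, hleast, ?_⟩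
  · refine iSup₂_le fun p hp => ?_
    rw [← hsub]
    exact EReal.sub_le_sub (ell_le_of_mem_regionCDelta hd hp) le_rfl
  · rw [← hsub, ← hell]
    exact le_iSup₂ (f := fun (p : ℝ × ℝ) (_ : p ∈ regionCDelta d) =>
      ell d p.1 p.2 - (d : EReal)) (π, π) hmem
  · rw [← hsub, ← hell]
    have hdist : dist (Configuration.of 0 0 π).pos (Configuration.of d 0 π).pos = d := by
      simp [Configuration.of, EuclideanSpace.dist_eq, Fin.sum_univ_two, Real.dist_eq, hd.le]
    exact le_iSup_of_le _ (le_iSup_of_le _ (le_iSup_of_le hdist le_rfl))
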